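/- Let $\mathcal O$ be a Dedekind domain and let $\pi\in\mathcal O$ generate a non-zero prime ideal whose residue field $\mathcal O/(\pi)$ is finite with $q$ elements. For an $\mathcal O$-algebra $B$ let $W_n(B)$ be the $\mathcal O$-algebra of truncated $\pi$-typical Witt vectors $(b_0,\dots,b_n)$: its underlying set is $B^{n+1}$, and its structure is the unique one, functorial in $B$, for which the ghost components $w_i=\sum_{k\le i}\pi^k b_k^{q^{i-k}}$ $(0\le i\le n)$ are homomorphisms of $\mathcal O$-algebras $W_n(B)\to B$. Let $R_*=(R_0\rightrightarrows R_1\rightrightarrows\cdots)$ be a prolongation sequence of $\mathcal O$-algebras over $\mathcal O_*$. That is, it consists of $\mathcal O$-algebras $R_n$, $\mathcal O$-algebra homomorphisms $u_n\colon R_n\to R_{n+1}$ and maps $\delta_n\colon R_n\to R_{n+1}$ such that, for all $n$, all $x,y\in R_n$ and all $c\in\mathcal O$, $$\delta_n(x+y)=\delta_n(x)+\delta_n(y)+C_\pi(u_n(x),u_n(y)),\qquad \delta_n(xy)=u_n(x)^q\delta_n(y)+u_n(y)^q\delta_n(x)+\pi\,\delta_n(x)\delta_n(y),$$ $$u_{n+1}\circ\delta_n=\delta_{n+1}\circ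 u_n,\qquad \delta_n(c\cdot 1)=\pi^{-1}(c-c^q)\cdot 1,$$ where $C_\pi(X,Y)=\pi^{-1}(X^q+Y^q-(X+Y)^q)\in\mathcal O[X,Y]$. For an $R_n$-algebra $B$, the ring $W_n(B)$ is an $R_0$-algebra through the composite of $R_0\to W_n(R_n)$, $c\mapsto(P_0(c),\dots,P_n(c))$, with the map $W_n(R_n)\to W_n(B)$ induced by $R_n\to B$. Here $P_0(c)=c$ and, for $m\ge 1$ and with elements of $R_k$ mapped to $R_m$ by the $u_i$, $$P_m(c)=\delta P_{m-1}(c)+\sum_{i=0}^{m-2}\ \sum_{j=1}^{q^{m-1-i}}\pi^{i+j-m}\binom{q^{m-1-i}}{j}P_i(c)^{q(q^{m-1-i}-j)}\,\bigl(\delta P_i(c)\bigr)^j .$$ For a ring $R$ let $\mathrm{Sp}_R$ be the category of sheaves of sets on the category of affine $R$-schemes with the étale topology. For $X$ in $\mathrm{Sp}_{R_0}$ and $n\ge 0$, let $J^nX$ be the functor on affine $R_n$-schemes given by $(J^nX)(B)=X(W_n(B))$ for every $R_n$-algebra $B$. A morphism $f\colon X\to Y$ in $\mathrm{Sp}_{R_0}$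 induces a morphism $J^nf\colon J^nX\to J^nY$. Let $f\colon X\to Y$ be a morphism of set-valued contravariant functors on affine $R$-schemes (in particular, a morphism of sheaves). - $f$ is *formally étale* if, for every closed immersion $\bar T\to T$ of affine $R$-schemes defined by a nilpotent ideal, the map $X(T)\to X(\bar T)\times_{Y(\bar T)}Y(T)$ is bijective. - $f$ is *locally of finite presentation* if, for every cofiltered system $(T_i)$ of affine $R$-schemes over $Y$, the map $\operatorname{colim}_i\operatorname{Hom}_Y(T_i,X)\to\operatorname{Hom}_Y(\lim_iT_i,X)$ is bijective. - $f$ is *étale* if it is formally étale and locally of finite presentation. **Proposition.** Let $n\ge 0$ and let $f\colon X\to Y$ be a morphism in $\mathrm{Sp}_{R_0}$. If $f$ is formally étale (respectively locally of finite presentation, respectively étale), then $J^nf\colon J^nX\to J^nY$ has the same property. -/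

import Mathlib

open CategoryTheory Limits Opposite

universe w v u

set_option linter.unusedSectionVars false

noncomputable section

/-! ### Arithmetic modulo `π` -/

section Congruences

variable {𝒪 : Type v} [CommRing 𝒪] (π : 𝒪)

/-- The cardinality `q` of the residue ring `𝒪 / (π)`. -/
def residueCard : ℕ := Nat.card (𝒪 ⧸ Ideal.span {π})

variable [IsDomain 𝒪] [Fact (Prime π)] [Finite (𝒪 ⧸ Ideal.span {π})]

/-- The `q`-th power map on the reduction modulo `π` of an `𝒪`-algebra is a ring homomorphism. -/
theorem exists_frobenius (A : Type*) [CommRing A] [Algebra 𝒪 A] :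
    ∃ F : (A ⧸ Ideal.span {algebraMap 𝒪 A π}) →+* (A ⧸ Ideal.span {algebraMap 𝒪 A π}),
      (∀ x, F x = x ^ residueCard π) ∧
      ∀ c : 𝒪, F (Ideal.Quotient.mk _ (algebraMap 𝒪 A c)) =
        Ideal.Quotient.mk _ (algebraMap 𝒪 A c) := by
  have hp : Prime π := Fact.out
  have : (Ideal.span {π}).IsPrime := (Ideal.span_singleton_prime hp.ne_zero).2 hp
  let : Fintype (𝒪 ⧸ Ideal.span {π}) := Fintype.ofFinite _
  let : DecidableEq (𝒪 ⧸ Ideal.span {π}) := Classical.decEq _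
  let : Field (𝒪 ⧸ Ideal.span {π}) := Fintype.fieldOfDomain _
  let g : (𝒪 ⧸ Ideal.span {π}) →+* (A ⧸ Ideal.span {algebraMap 𝒪 A π}) :=
    Ideal.Quotient.lift _ ((Ideal.Quotient.mk _).comp (algebraMap 𝒪 A)) (by
      intro a ha
      obtain ⟨b, rfl⟩ := Ideal.mem_span_singleton.1 ha
      rw [RingHom.comp_apply, map_mul, Ideal.Quotient.eq_zero_iff_mem, Ideal.mem_span_singleton]
      exact dvd_mul_right _ _)
  let := g.toAlgebra
  have hq : residueCard π = Fintype.card (𝒪 ⧸ Ideal.span {π}) := Nat.card_eq_fintype_card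
  refine ⟨(FiniteField.frobeniusAlgHom (𝒪 ⧸ Ideal.span {π}) _).toRingHom, fun x => ?_,
    fun c => ?_⟩
  · rw [hq]; rfl
  · exact (FiniteField.frobeniusAlgHom (𝒪 ⧸ Ideal.span {π})
      (A ⧸ Ideal.span {algebraMap 𝒪 A π})).commutes (Ideal.Quotient.mk _ c)

theorem dvd_sub_iff_mk {A : Type*} [CommRing A] (p a b : A) :
    p ∣ a - b ↔ Ideal.Quotient.mk (Ideal.span {p}) a = Ideal.Quotient.mk (Ideal.span {p}) b := by
  rw [Ideal.Quotient.eq, Ideal.mem_span_singleton]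

theorem dvd_sub_pow_residueCard (c : 𝒪) : π ∣ c - c ^ residueCard π := by
  obtain ⟨F, hF, hF'⟩ := exists_frobenius π 𝒪
  have h := hF' c
  rw [hF, ← map_pow, eq_comm, ← dvd_sub_iff_mk] at h
  exact h

theorem dvd_add_pow_sub {A : Type*} [CommRing A] [Algebra 𝒪 A] (a b : A) :
    algebraMap 𝒪 A π ∣ a ^ residueCard π + b ^ residueCard π - (a + b) ^ residueCard π := by
  obtain ⟨F, hF, -⟩ := exists_frobenius π A
  rw [dvd_sub_iff_mk, map_add, map_pow, map_pow, map_pow, map_add, ← hF, ← hF, ← hF, map_add]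

theorem dvd_residueCard (A : Type*) [CommRing A] [Algebra 𝒪 A] :
    algebraMap 𝒪 A π ∣ (residueCard π : A) := by
  have hp : Prime π := Fact.out
  have h : π ∣ (residueCard π : 𝒪) := by
    rw [← Ideal.mem_span_singleton, ← Ideal.Quotient.eq_zero_iff_mem, map_natCast]
    let : Fintype (𝒪 ⧸ Ideal.span {π}) := Fintype.ofFinite _
    rw [residueCard, Nat.card_eq_fintype_card]
    exact Nat.cast_card_eq_zero _
  simpa using map_dvd (algebraMap 𝒪 A) h

theorem dvd_pow_residueCard_sub {A : Type*} [CommRing A] [Algebra 𝒪 A] {r : ℕ} {a b : A}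
    (h : algebraMap 𝒪 A π ^ (r + 1) ∣ a - b) :
    algebraMap 𝒪 A π ^ (r + 2) ∣ a ^ residueCard π - b ^ residueCard π := by
  obtain ⟨c, hc⟩ := h
  obtain ⟨d, hd⟩ := dvd_residueCard π A
  obtain rfl : a = b + algebraMap 𝒪 A π ^ (r + 1) * c := by rw [← hc]; ring
  obtain ⟨k, hk⟩ := Polynomial.powAddExpansion b (algebraMap 𝒪 A π ^ (r + 1) * c) (residueCard π)
  rw [hk, hd]
  exact ⟨d * b ^ (residueCard π - 1) * c + k * algebraMap 𝒪 A π ^ r * c ^ 2, by ring⟩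

theorem dvd_pow_pow_sub {A : Type*} [CommRing A] [Algebra 𝒪 A] {a b : A}
    (h : algebraMap 𝒪 A π ∣ a - b) (m : ℕ) :
    algebraMap 𝒪 A π ^ (m + 1) ∣ a ^ residueCard π ^ m - b ^ residueCard π ^ m := by
  induction m with
  | zero => simpa using h
  | succ m ih => simpa only [pow_succ (residueCard π), pow_mul] using dvd_pow_residueCard_sub π ih

/-- Two homomorphisms out of a polynomial ring such that the first lifts the `q`-th power of the
second on the variables satisfy the same congruence everywhere. -/
theorem dvd_sub_pow_of_X {σ : Type*} {A : Type*} [CommRing A] [Algebra 𝒪 A]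
    (φ f : MvPolynomial σ 𝒪 →ₐ[𝒪] A)
    (h : ∀ s, algebraMap 𝒪 A π ∣ φ (.X s) - f (.X s) ^ residueCard π) (Q : MvPolynomial σ 𝒪) :
    algebraMap 𝒪 A π ∣ φ Q - f Q ^ residueCard π := by
  obtain ⟨F, hF, hF'⟩ := exists_frobenius π A
  have key : (Ideal.Quotient.mk (Ideal.span {algebraMap 𝒪 A π})).comp φ.toRingHom =
      (F.comp (Ideal.Quotient.mk _)).comp f.toRingHom := by
    refine MvPolynomial.ringHom_ext (fun c => ?_) (fun s => ?_)
    · have h0 := hF' c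
      have h1 : φ (MvPolynomial.C c) = algebraMap 𝒪 A c := φ.commutes c
      have h2 : f (MvPolynomial.C c) = algebraMap 𝒪 A c := f.commutes c
      simpa [h1, h2] using h0.symm
    · simpa [hF, ← map_pow] using (dvd_sub_iff_mk _ _ _).1 (h s)
  have := RingHom.congr_fun key Q
  rw [dvd_sub_iff_mk, map_pow, ← hF]
  exact this

theorem algebraMap_pi_ne_zero (σ : Type*) : algebraMap 𝒪 (MvPolynomial σ 𝒪) π ≠ 0 := by
  have hp : Prime π := Fact.out
  rw [MvPolynomial.algebraMap_eq, Ne, MvPolynomial.C_eq_zero]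
  exact hp.ne_zero

end Congruences

/-! ### Witt vectors -/

/-- The underlying set `B ^ (n + 1)` of the ring `W_n(B)` of `π`-typical Witt vectors. -/
@[ext]
structure WittVec {𝒪 : Type v} (π : 𝒪) (n : ℕ) (B : Type u) where
  /-- The Witt components `(x_0, …, x_n)`. -/
  coeff : Fin (n + 1) → B

namespace WittVec

variable {𝒪 : Type v} [CommRing 𝒪] {π : 𝒪} {n : ℕ}

section Ghost

variable {A : Type*} [CommRing A] [Algebra 𝒪 A] {A' : Type*} [CommRing A'] [Algebra 𝒪 A']

variable (π) in
/-- The Witt polynomial `w_i = x_0 ^ (q ^ i) + π x_1 ^ (q ^ (i - 1)) + ⋯ + π ^ i x_i`. -/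
def wittSum (x : ℕ → A) (i : ℕ) : A :=
  ∑ k ∈ Finset.range (i + 1), algebraMap 𝒪 A π ^ k * x k ^ residueCard π ^ (i - k)

/-- The `i`-th ghost component `w_i(x_0, …, x_i)` of a Witt vector, for `i ≤ n`. -/
def ghost (x : WittVec π n A) (i : Fin (n + 1)) : A :=
  wittSum π (fun k => if h : k < n + 1 then x.coeff ⟨k, h⟩ else 0) i

theorem wittSum_congr {x y : ℕ → A} {i : ℕ} (h : ∀ k ≤ i, x k = y k) :
    wittSum π x i = wittSum π y i :=
  Finset.sum_congr rfl fun k hk => by rw [h k (Nat.lt_succ_iff.1 (Finset.mem_range.1 hk))]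

theorem map_wittSum (f : A →ₐ[𝒪] A') (x : ℕ → A) (i : ℕ) :
    f (wittSum π x i) = wittSum π (fun k => f (x k)) i := by
  simp [wittSum, map_sum]

theorem wittSum_succ (x : ℕ → A) (i : ℕ) :
    wittSum π x (i + 1) =
      wittSum π (fun k => x k ^ residueCard π) i + algebraMap 𝒪 A π ^ (i + 1) * x (i + 1) := by
  rw [wittSum, Finset.sum_range_succ, wittSum]
  congr 1
  · refine Finset.sum_congr rfl fun k hk => ?_
    rw [← pow_mul, ← pow_succ', Nat.succ_sub (Nat.lt_succ_iff.1 (Finset.mem_range.1 hk))]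
  · simp

variable [IsDomain 𝒪] [Fact (Prime π)] [Finite (𝒪 ⧸ Ideal.span {π})]

theorem wittSum_sub_dvd {x y : ℕ → A} (h : ∀ k, algebraMap 𝒪 A π ∣ x k - y k) (i : ℕ) :
    algebraMap 𝒪 A π ^ (i + 1) ∣ wittSum π x i - wittSum π y i := by
  rw [wittSum, wittSum, ← Finset.sum_sub_distrib]
  refine Finset.dvd_sum fun k hk => ?_
  rw [← mul_sub]
  obtain ⟨c, hc⟩ := dvd_pow_pow_sub π (h k) (i - k)
  have hk' : k + (i - k + 1) = i + 1 := by have := Finset.mem_range.1 hk; omega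
  exact ⟨c, by rw [hc, ← mul_assoc, ← pow_add, hk']⟩

theorem wittSum_compat {σ : Type*} (φ : MvPolynomial σ 𝒪 →ₐ[𝒪] MvPolynomial σ 𝒪)
    (hφ : ∀ Q, algebraMap 𝒪 _ π ∣ φ Q - Q ^ residueCard π) (x : ℕ → MvPolynomial σ 𝒪) (i : ℕ) :
    algebraMap 𝒪 _ π ^ (i + 1) ∣ φ (wittSum π x i) - wittSum π x (i + 1) := by
  rw [map_wittSum, wittSum_succ, ← sub_sub]
  exact dvd_sub (wittSum_sub_dvd (fun k => hφ _) i) (dvd_mul_right _ _)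

/-- A sequence in a polynomial ring with a lift `φ` of the `q`-Frobenius is a sequence of ghost
components as soon as it satisfies the congruences `φ (v_i) ≡ v_{i+1}` modulo `π ^ (i + 1)`. -/
theorem exists_wittSum_eq {σ : Type*} (φ : MvPolynomial σ 𝒪 →ₐ[𝒪] MvPolynomial σ 𝒪)
    (hφ : ∀ Q, algebraMap 𝒪 _ π ∣ φ Q - Q ^ residueCard π) (v : ℕ → MvPolynomial σ 𝒪)
    (hv : ∀ i, algebraMap 𝒪 _ π ^ (i + 1) ∣ φ (v i) - v (i + 1)) (N : ℕ) :
    ∃ x : ℕ → MvPolynomial σ 𝒪, ∀ i ≤ N, wittSum π x i = v i := by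
  induction N with
  | zero => exact ⟨fun _ => v 0, fun i hi => by obtain rfl := Nat.le_zero.1 hi; simp [wittSum]⟩
  | succ N ih =>
    obtain ⟨x, hx⟩ := ih
    obtain ⟨c, hc⟩ : algebraMap 𝒪 _ π ^ (N + 1) ∣
        v (N + 1) - wittSum π (fun k => x k ^ residueCard π) N := by
      have h1 := hv N
      rw [← hx N le_rfl, map_wittSum] at h1
      have h2 := wittSum_sub_dvd (π := π) (fun k => hφ (x k)) N
      have h3 := dvd_sub h2 h1
      have h4 : ∀ a b c : MvPolynomial σ 𝒪, a - b - (a - c) = c - b := fun a b c => by ring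
      rwa [h4] at h3
    refine ⟨Function.update x (N + 1) c, fun i hi => ?_⟩
    rcases Nat.lt_or_ge i (N + 1) with h | h
    · rw [← hx i (by omega)]
      exact wittSum_congr fun k hk => Function.update_of_ne (by omega) _ _
    · obtain rfl : i = N + 1 := by omega
      rw [wittSum_succ, Function.update_self, ← hc]
      have : wittSum π (fun k => Function.update x (N + 1) c k ^ residueCard π) N =
          wittSum π (fun k => x k ^ residueCard π) N :=
        wittSum_congr fun k hk => by rw [Function.update_of_ne (by omega)]
      rw [this]; ring

theorem wittSum_injective {σ : Type*} {x y : ℕ → MvPolynomial σ 𝒪} {N : ℕ}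
    (h : ∀ i ≤ N, wittSum π x i = wittSum π y i) : ∀ i ≤ N, x i = y i := by
  intro i
  induction i using Nat.strong_induction_on with
  | _ i ih =>
    intro hi
    have h1 := h i hi
    cases i with
    | zero => simpa [wittSum] using h1
    | succ i =>
      rw [wittSum_succ, wittSum_succ, wittSum_congr (y := fun k => y k ^ residueCard π)
        (fun k hk => by rw [ih k (by omega) (by omega)])] at h1
      exact mul_left_cancel₀ (pow_ne_zero _ (algebraMap_pi_ne_zero π σ)) (add_left_cancel h1)

theorem ghost_injective {σ : Type*} {x y : WittVec π n (MvPolynomial σ 𝒪)}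
    (h : ∀ i, x.ghost i = y.ghost i) : x = y := by
  ext1
  funext i
  have := wittSum_injective (π := π) (N := n) (fun i hi => h ⟨i, by omega⟩) i
    (Nat.lt_succ_iff.1 i.2)
  simpa [Nat.lt_succ_iff.1 i.2] using this

end Ghost

section StructurePolynomials

variable [IsDomain 𝒪] [Fact (Prime π)] [Finite (𝒪 ⧸ Ideal.span {π})]

/-- Coefficientwise application of a map. -/
def mapFun {A B : Type*} (f : A → B) (x : WittVec π n A) : WittVec π n B := ⟨fun i => f (x.coeff i)⟩

theorem ghost_mapFun {A B : Type*} [CommRing A] [Algebra 𝒪 A] [CommRing B] [Algebra 𝒪 B]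
    (f : A →ₐ[𝒪] B) (x : WittVec π n A) (i : Fin (n + 1)) :
    (mapFun f x).ghost i = f (x.ghost i) := by
  rw [ghost, ghost, map_wittSum]
  refine wittSum_congr fun k hk => ?_
  have : k < n + 1 := by have := i.2; omega
  simp [this, mapFun]

variable (π n) in
/-- The generic Witt vectors, whose components are the variables of a polynomial ring. -/
def generic {m : ℕ} (j : Fin m) : WittVec π n (MvPolynomial (Fin m × Fin (n + 1)) 𝒪) :=
  ⟨fun i => .X (j, i)⟩

variable (π n) in
theorem exists_structurePoly {m : ℕ} (Q : MvPolynomial (Fin m) 𝒪) :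
    ∃ S : WittVec π n (MvPolynomial (Fin m × Fin (n + 1)) 𝒪),
      ∀ i, S.ghost i = Q.aeval (fun j => (generic π n j).ghost i) := by
  let φ : MvPolynomial (Fin m × Fin (n + 1)) 𝒪 →ₐ[𝒪] MvPolynomial (Fin m × Fin (n + 1)) 𝒪 :=
    MvPolynomial.aeval fun s => .X s ^ residueCard π
  have hφ : ∀ P, algebraMap 𝒪 _ π ∣ φ P - P ^ residueCard π := fun P =>
    dvd_sub_pow_of_X π φ (AlgHom.id 𝒪 _) (fun s => by simp [φ]) P
  let g : Fin m → ℕ → MvPolynomial (Fin m × Fin (n + 1)) 𝒪 := fun j =>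
    wittSum π (fun k => if h : k < n + 1 then (generic π n j).coeff ⟨k, h⟩ else 0)
  have hv : ∀ i, algebraMap 𝒪 _ π ^ (i + 1) ∣
      φ (Q.aeval fun j => g j i) - Q.aeval fun j => g j (i + 1) := by
    intro i
    rw [dvd_sub_iff_mk]
    have h1 : φ (Q.aeval fun j => g j i) = Q.aeval fun j => φ (g j i) := by
      rw [← AlgHom.comp_apply, MvPolynomial.comp_aeval]
    rw [h1, MvPolynomial.aeval_def, MvPolynomial.aeval_def, MvPolynomial.hom_eval₂,
      MvPolynomial.hom_eval₂]
    congr 1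
    funext j
    exact (dvd_sub_iff_mk _ _ _).1 (wittSum_compat φ hφ _ i)
  obtain ⟨x, hx⟩ := exists_wittSum_eq φ hφ _ hv n
  refine ⟨⟨fun i => x i⟩, fun i => ?_⟩
  have h2 := hx i (Nat.lt_succ_iff.1 i.2)
  rw [ghost]
  refine (wittSum_congr fun k hk => ?_).trans h2
  have : k < n + 1 := by have := i.2; omega
  simp [this]

variable (π n) in
/-- The polynomials in the Witt components which compute, on ghost components, the polynomial
operation `Q`. They are unique because the ghost map of a polynomial ring over `𝒪` is injective. -/
def structurePoly {m : ℕ} (Q : MvPolynomial (Fin m) 𝒪) :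
    WittVec π n (MvPolynomial (Fin m × Fin (n + 1)) 𝒪) :=
  (exists_structurePoly π n Q).choose

variable {B C : Type*} [CommRing B] [Algebra 𝒪 B] [CommRing C] [Algebra 𝒪 C]

/-- The operation on Witt vectors which on ghost components is the polynomial operation `Q`. -/
def op {m : ℕ} (Q : MvPolynomial (Fin m) 𝒪) (x : Fin m → WittVec π n B) : WittVec π n B :=
  mapFun (MvPolynomial.aeval fun s : Fin m × Fin (n + 1) => (x s.1).coeff s.2) (structurePoly π n Q)

theorem ghost_op {m : ℕ} (Q : MvPolynomial (Fin m) 𝒪) (x : Fin m → WittVec π n B)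
    (i : Fin (n + 1)) : (op Q x).ghost i = Q.aeval fun j => (x j).ghost i := by
  rw [op, ghost_mapFun, structurePoly, (exists_structurePoly π n Q).choose_spec i,
    ← AlgHom.comp_apply, MvPolynomial.comp_aeval]
  congr 2
  funext j
  rw [← ghost_mapFun]
  congr 1
  ext k
  simp [mapFun, generic]

theorem mapFun_op {m : ℕ} (f : B →ₐ[𝒪] C) (Q : MvPolynomial (Fin m) 𝒪)
    (x : Fin m → WittVec π n B) : mapFun f (op Q x) = op Q (fun j => mapFun f (x j)) := by
  ext i
  simp only [mapFun, op]
  rw [← AlgHom.comp_apply, MvPolynomial.comp_aeval]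

variable (π n B) in
/-- The image of a scalar: the Witt vector whose ghost components are all equal to the scalar. -/
def scalar (c : 𝒪) : WittVec π n B := op (.C c) Fin.elim0

instance : Zero (WittVec π n B) := ⟨scalar π n B 0⟩
instance : One (WittVec π n B) := ⟨scalar π n B 1⟩
instance : Add (WittVec π n B) := ⟨fun x y => op (.X 0 + .X 1) ![x, y]⟩
instance : Mul (WittVec π n B) := ⟨fun x y => op (.X 0 * .X 1) ![x, y]⟩
instance : Neg (WittVec π n B) := ⟨fun x => op (-.X 0) ![x]⟩

theorem ghost_scalar (c : 𝒪) (i : Fin (n + 1)) :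
    (scalar π n B c).ghost i = algebraMap 𝒪 B c := by
  rw [scalar, ghost_op, MvPolynomial.aeval_C]

theorem ghost_zero (i : Fin (n + 1)) : (0 : WittVec π n B).ghost i = 0 :=
  (ghost_scalar 0 i).trans (map_zero _)

theorem ghost_one (i : Fin (n + 1)) : (1 : WittVec π n B).ghost i = 1 :=
  (ghost_scalar 1 i).trans (map_one _)

theorem ghost_add (x y : WittVec π n B) (i : Fin (n + 1)) :
    (x + y).ghost i = x.ghost i + y.ghost i := (ghost_op _ _ i).trans (by simp)

theorem ghost_mul (x y : WittVec π n B) (i : Fin (n + 1)) :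
    (x * y).ghost i = x.ghost i * y.ghost i := (ghost_op _ _ i).trans (by simp)

theorem ghost_neg (x : WittVec π n B) (i : Fin (n + 1)) :
    (-x).ghost i = -x.ghost i := (ghost_op _ _ i).trans (by simp)

theorem mapFun_scalar (f : B →ₐ[𝒪] C) (c : 𝒪) :
    mapFun f (scalar π n B c) = scalar π n C c := by
  rw [scalar, mapFun_op, scalar]
  congr 1
  funext j
  exact j.elim0

theorem mapFun_zero (f : B →ₐ[𝒪] C) : mapFun f (0 : WittVec π n B) = 0 := mapFun_scalar f 0

theorem mapFun_one (f : B →ₐ[𝒪] C) : mapFun f (1 : WittVec π n B) = 1 := mapFun_scalar f 1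

theorem mapFun_add (f : B →ₐ[𝒪] C) (x y : WittVec π n B) :
    mapFun f (x + y) = mapFun f x + mapFun f y :=
  (mapFun_op f _ _).trans (congrArg _ (by funext j; fin_cases j <;> rfl))

theorem mapFun_mul (f : B →ₐ[𝒪] C) (x y : WittVec π n B) :
    mapFun f (x * y) = mapFun f x * mapFun f y :=
  (mapFun_op f _ _).trans (congrArg _ (by funext j; fin_cases j <;> rfl))

theorem mapFun_neg (f : B →ₐ[𝒪] C) (x : WittVec π n B) :
    mapFun f (-x) = -mapFun f x :=
  (mapFun_op f _ _).trans (congrArg _ (by funext j; fin_cases j; rfl))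

variable (𝒪 B) in
/-- The presentation of `B` as a quotient of a polynomial ring over `𝒪`. -/
def presentation : MvPolynomial B 𝒪 →ₐ[𝒪] B := MvPolynomial.aeval id

theorem exists_lift (x : WittVec π n B) :
    ∃ y : WittVec π n (MvPolynomial B 𝒪), mapFun (presentation 𝒪 B) y = x :=
  ⟨⟨fun i => .X (x.coeff i)⟩, by ext i; simp [mapFun, presentation]⟩

instance : CommRing (WittVec π n B) where
  add_assoc x y z := by
    obtain ⟨x, rfl⟩ := exists_lift x
    obtain ⟨y, rfl⟩ := exists_lift y
    obtain ⟨z, rfl⟩ := exists_lift z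
    simp only [← mapFun_add]
    exact congrArg _ (ghost_injective fun i => by simp only [ghost_add]; ring)
  zero_add x := by
    obtain ⟨x, rfl⟩ := exists_lift x
    rw [← mapFun_zero (presentation 𝒪 B), ← mapFun_add]
    exact congrArg _ (ghost_injective fun i => by simp only [ghost_add, ghost_zero]; ring)
  add_zero x := by
    obtain ⟨x, rfl⟩ := exists_lift x
    rw [← mapFun_zero (presentation 𝒪 B), ← mapFun_add]
    exact congrArg _ (ghost_injective fun i => by simp only [ghost_add, ghost_zero]; ring)
  add_comm x y := by
    obtain ⟨x, rfl⟩ := exists_lift x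
    obtain ⟨y, rfl⟩ := exists_lift y
    simp only [← mapFun_add]
    exact congrArg _ (ghost_injective fun i => by simp only [ghost_add]; ring)
  neg_add_cancel x := by
    obtain ⟨x, rfl⟩ := exists_lift x
    rw [← mapFun_zero (presentation 𝒪 B), ← mapFun_neg, ← mapFun_add]
    exact congrArg _ (ghost_injective fun i => by
      simp only [ghost_add, ghost_neg, ghost_zero]; ring)
  mul_assoc x y z := by
    obtain ⟨x, rfl⟩ := exists_lift x
    obtain ⟨y, rfl⟩ := exists_lift y
    obtain ⟨z, rfl⟩ := exists_lift z
    simp only [← mapFun_mul]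
    exact congrArg _ (ghost_injective fun i => by simp only [ghost_mul]; ring)
  one_mul x := by
    obtain ⟨x, rfl⟩ := exists_lift x
    rw [← mapFun_one (presentation 𝒪 B), ← mapFun_mul]
    exact congrArg _ (ghost_injective fun i => by simp only [ghost_mul, ghost_one]; ring)
  mul_one x := by
    obtain ⟨x, rfl⟩ := exists_lift x
    rw [← mapFun_one (presentation 𝒪 B), ← mapFun_mul]
    exact congrArg _ (ghost_injective fun i => by simp only [ghost_mul, ghost_one]; ring)
  mul_comm x y := by
    obtain ⟨x, rfl⟩ := exists_lift x
    obtain ⟨y, rfl⟩ := exists_lift y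
    simp only [← mapFun_mul]
    exact congrArg _ (ghost_injective fun i => by simp only [ghost_mul]; ring)
  zero_mul x := by
    obtain ⟨x, rfl⟩ := exists_lift x
    rw [← mapFun_zero (presentation 𝒪 B), ← mapFun_mul]
    exact congrArg _ (ghost_injective fun i => by simp only [ghost_mul, ghost_zero]; ring)
  mul_zero x := by
    obtain ⟨x, rfl⟩ := exists_lift x
    rw [← mapFun_zero (presentation 𝒪 B), ← mapFun_mul]
    exact congrArg _ (ghost_injective fun i => by simp only [ghost_mul, ghost_zero]; ring)
  left_distrib x y z := by
    obtain ⟨x, rfl⟩ := exists_lift x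
    obtain ⟨y, rfl⟩ := exists_lift y
    obtain ⟨z, rfl⟩ := exists_lift z
    simp only [← mapFun_mul, ← mapFun_add]
    exact congrArg _ (ghost_injective fun i => by simp only [ghost_mul, ghost_add]; ring)
  right_distrib x y z := by
    obtain ⟨x, rfl⟩ := exists_lift x
    obtain ⟨y, rfl⟩ := exists_lift y
    obtain ⟨z, rfl⟩ := exists_lift z
    simp only [← mapFun_mul, ← mapFun_add]
    exact congrArg _ (ghost_injective fun i => by simp only [ghost_mul, ghost_add]; ring)
  nsmul := nsmulRec
  zsmul := zsmulRec

variable (π n B) in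
/-- The structure homomorphism of the `𝒪`-algebra `W_n(B)`. -/
def scalarHom : 𝒪 →+* WittVec π n B where
  toFun := scalar π n B
  map_zero' := rfl
  map_one' := rfl
  map_add' c d := by
    rw [← mapFun_scalar (presentation 𝒪 B), ← mapFun_scalar (presentation 𝒪 B),
      ← mapFun_scalar (presentation 𝒪 B), ← mapFun_add]
    exact congrArg _ (ghost_injective fun i => by simp only [ghost_add, ghost_scalar, map_add])
  map_mul' c d := by
    rw [← mapFun_scalar (presentation 𝒪 B), ← mapFun_scalar (presentation 𝒪 B),
      ← mapFun_scalar (presentation 𝒪 B), ← mapFun_mul]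
    exact congrArg _ (ghost_injective fun i => by simp only [ghost_mul, ghost_scalar, map_mul])

instance : Algebra 𝒪 (WittVec π n B) := (scalarHom π n B).toAlgebra

theorem algebraMap_apply (c : 𝒪) : algebraMap 𝒪 (WittVec π n B) c = scalar π n B c := rfl

variable (π n) in
/-- Functoriality: the homomorphism `W_n(f) : W_n(B) → W_n(C)` acts componentwise. -/
def map (f : B →ₐ[𝒪] C) : WittVec π n B →ₐ[𝒪] WittVec π n C where
  toFun := mapFun f
  map_zero' := mapFun_zero f
  map_one' := mapFun_one f
  map_add' := mapFun_add f
  map_mul' := mapFun_mul f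
  commutes' := mapFun_scalar f

end StructurePolynomials

end WittVec

/-! ### Prolongation sequences -/

section Prolongation

variable {𝒪 : Type v} [CommRing 𝒪] (π : 𝒪) [IsDomain 𝒪] [Fact (Prime π)]
  [Finite (𝒪 ⧸ Ideal.span {π})]

/-- The polynomial `C_π(X, Y) = (X ^ q + Y ^ q - (X + Y) ^ q) / π` with coefficients in `𝒪`. -/
def carryPoly : MvPolynomial (Fin 2) 𝒪 :=
  (dvd_add_pow_sub π (.X 0 : MvPolynomial (Fin 2) 𝒪) (.X 1)).choose

theorem pi_mul_carryPoly : algebraMap 𝒪 _ π * carryPoly π =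
    .X 0 ^ residueCard π + .X 1 ^ residueCard π - (.X 0 + .X 1) ^ residueCard π :=
  (dvd_add_pow_sub π (.X 0 : MvPolynomial (Fin 2) 𝒪) (.X 1)).choose_spec.symm

theorem pi_mul_aeval_carryPoly {B : Type*} [CommRing B] [Algebra 𝒪 B] (x y : B) :
    algebraMap 𝒪 B π * MvPolynomial.aeval ![x, y] (carryPoly π) =
      x ^ residueCard π + y ^ residueCard π - (x + y) ^ residueCard π := by
  have := congrArg (MvPolynomial.aeval ![x, y]) (pi_mul_carryPoly π)
  simpa using this

/-- The `π`-derivation `δ(c) = (c - c ^ q) / π` of the base ring `𝒪`. -/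
def baseDeriv (c : 𝒪) : 𝒪 := (dvd_sub_pow_residueCard π c).choose

theorem pi_mul_baseDeriv (c : 𝒪) : π * baseDeriv π c = c - c ^ residueCard π :=
  (dvd_sub_pow_residueCard π c).choose_spec.symm

/-- A prolongation sequence `C_0 ⇉ C_1 ⇉ C_2 ⇉ ⋯` of `𝒪`-algebras lying over the constant
prolongation sequence `𝒪_*` (given by `𝒪`, the identity and `δ(c) = (c - c ^ q) / π`). -/
structure ProlongationSequence where
  /-- The rings `C_n`. -/
  ring : ℕ → Type u
  [commRing : ∀ n, CommRing (ring n)]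
  [algebra : ∀ n, Algebra 𝒪 (ring n)]
  /-- The homomorphisms of `𝒪`-algebras `u_n : C_n → C_{n+1}`. -/
  hom : ∀ n, ring n →ₐ[𝒪] ring (n + 1)
  /-- The `π`-derivations `δ_n : C_n → C_{n+1}` relative to `u_n`. -/
  deriv : ∀ n, ring n → ring (n + 1)
  deriv_add : ∀ n x y, deriv n (x + y) =
    deriv n x + deriv n y + MvPolynomial.aeval ![hom n x, hom n y] (carryPoly π)
  deriv_mul : ∀ n x y, deriv n (x * y) =
    hom n x ^ residueCard π * deriv n y + hom n y ^ residueCard π * deriv n x +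
      algebraMap 𝒪 _ π * deriv n x * deriv n y
  hom_deriv : ∀ n x, hom (n + 1) (deriv n x) = deriv (n + 1) (hom n x)
  /-- The structure maps `𝒪 → C_n` form a morphism of prolongation sequences `𝒪_* → C_*`. -/
  deriv_algebraMap : ∀ n c, deriv n (algebraMap 𝒪 _ c) = algebraMap 𝒪 _ (baseDeriv π c)

attribute [instance] ProlongationSequence.commRing ProlongationSequence.algebra

theorem exists_diffPoly (m : ℕ) : ∃ D : MvPolynomial (Fin 2) 𝒪,
    algebraMap 𝒪 _ π ^ (m + 1) * D =
      (.X 0 + algebraMap 𝒪 _ π * .X 1) ^ residueCard π ^ m - .X 0 ^ residueCard π ^ m := by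
  obtain ⟨D, hD⟩ := dvd_pow_pow_sub π (A := MvPolynomial (Fin 2) 𝒪)
    (a := .X 0 + algebraMap 𝒪 _ π * .X 1) (b := .X 0) (by simp) m
  exact ⟨D, hD.symm⟩

/-- The polynomial
`((X + π Y) ^ (q ^ m) - X ^ (q ^ m)) / π ^ (m + 1) = ∑_{j ≥ 1} π ^ (j - m - 1) (q ^ m choose j)
X ^ (q ^ m - j) Y ^ j` with coefficients in `𝒪`. -/
def diffPoly (m : ℕ) : MvPolynomial (Fin 2) 𝒪 := (exists_diffPoly π m).choose

theorem pi_pow_mul_aeval_diffPoly {B : Type*} [CommRing B] [Algebra 𝒪 B] (m : ℕ) (x y : B) :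
    algebraMap 𝒪 B π ^ (m + 1) * MvPolynomial.aeval ![x, y] (diffPoly π m) =
      (x + algebraMap 𝒪 B π * y) ^ residueCard π ^ m - x ^ residueCard π ^ m := by
  have h : algebraMap 𝒪 _ π ^ (m + 1) * diffPoly π m = _ := (exists_diffPoly π m).choose_spec
  have := congrArg (MvPolynomial.aeval ![x, y]) h
  simpa using this

theorem map_aeval_pair {B C : Type*} [CommRing B] [Algebra 𝒪 B] [CommRing C] [Algebra 𝒪 C]
    (f : B →ₐ[𝒪] C) (x y : B) (P : MvPolynomial (Fin 2) 𝒪) :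
    f (MvPolynomial.aeval ![x, y] P) = MvPolynomial.aeval ![f x, f y] P := by
  rw [← AlgHom.comp_apply, MvPolynomial.comp_aeval]
  congr 2
  funext j
  fin_cases j <;> rfl

variable {π}

namespace ProlongationSequence

variable (R : ProlongationSequence.{v, u} π)

/-- The components `P_0(c), …, P_N(c)` in `R_N` of the Witt vector attached to `c ∈ R_0`:
`P_0(c) = c`, and `P_{N+1}` is obtained from `P_0, …, P_N` by the recursion
`P_{N+1} = ∑_{k ≤ N} ((P_k ^ q + π δ P_k) ^ (q ^ (N - k)) - P_k ^ (q ^ (N + 1 - k))) /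
π ^ (N + 1 - k)`, whose summand for `k = N` is `δ P_N`. (Elements of `R_N` are mapped to `R_{N+1}`
by `u_N`; only the entries of index at most `N` are meaningful.) -/
def expSeq : (N : ℕ) → R.ring 0 → ℕ → R.ring N
  | 0, c, _ => c
  | N + 1, c, i =>
    if i ≤ N then R.hom N (expSeq N c i)
    else ∑ k ∈ Finset.range (N + 1), MvPolynomial.aeval
      ![R.hom N (expSeq N c k) ^ residueCard π, R.deriv N (expSeq N c k)] (diffPoly π (N - k))

/-- The lift of Frobenius `φ_n(x) = u_n(x) ^ q + π δ_n(x)`. -/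
def frob (n : ℕ) : R.ring n →ₐ[𝒪] R.ring (n + 1) :=
  have hc : ∀ c : 𝒪, R.hom n (algebraMap 𝒪 _ c) ^ residueCard π +
      algebraMap 𝒪 _ π * R.deriv n (algebraMap 𝒪 _ c) = algebraMap 𝒪 _ c := fun c => by
    rw [R.deriv_algebraMap, ← map_mul, pi_mul_baseDeriv, AlgHom.commutes, map_sub, map_pow]
    ring
  { toFun := fun x => R.hom n x ^ residueCard π + algebraMap 𝒪 _ π * R.deriv n x
    map_one' := by simpa using hc 1
    map_zero' := by simpa using hc 0
    map_add' := fun x y => by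
      rw [R.deriv_add, mul_add, pi_mul_aeval_carryPoly, map_add]
      ring
    map_mul' := fun x y => by
      rw [R.deriv_mul, map_mul]
      ring
    commutes' := hc }

theorem frob_apply (n : ℕ) (x : R.ring n) :
    R.frob n x = R.hom n x ^ residueCard π + algebraMap 𝒪 _ π * R.deriv n x := rfl

theorem wittSum_expSeq_of_le {N i : ℕ} (h : i ≤ N) (c : R.ring 0) :
    WittVec.wittSum π (R.expSeq (N + 1) c) i = R.hom N (WittVec.wittSum π (R.expSeq N c) i) := by
  rw [WittVec.map_wittSum]
  exact WittVec.wittSum_congr fun k hk => by rw [expSeq, if_pos (hk.trans h)]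

theorem wittSum_expSeq_succ (N : ℕ) (c : R.ring 0) :
    WittVec.wittSum π (R.expSeq (N + 1) c) (N + 1) =
      R.frob N (WittVec.wittSum π (R.expSeq N c) N) := by
  rw [WittVec.map_wittSum, WittVec.wittSum_succ]
  rw [WittVec.wittSum_congr (y := fun k => R.hom N (R.expSeq N c k) ^ residueCard π)
    (fun k hk => by rw [expSeq, if_pos hk])]
  rw [expSeq, if_neg (by omega), WittVec.wittSum, WittVec.wittSum, Finset.mul_sum,
    ← Finset.sum_add_distrib]
  refine Finset.sum_congr rfl fun k hk => ?_
  have hk' : N + 1 = k + (N - k + 1) := by have := Finset.mem_range.1 hk; omega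
  have hk'' : algebraMap 𝒪 (R.ring (N + 1)) π ^ (N + 1) =
      algebraMap 𝒪 (R.ring (N + 1)) π ^ k * algebraMap 𝒪 (R.ring (N + 1)) π ^ (N - k + 1) := by
    rw [← pow_add, ← hk']
  rw [frob_apply, hk'', mul_assoc, pi_pow_mul_aeval_diffPoly]
  ring

section Free

variable (π) (σ : Type u)

/-- The shift `T^(i) ↦ T^(i)` on polynomial rings in jet variables. -/
def freeHom (n : ℕ) :
    MvPolynomial (σ × Fin (n + 1)) 𝒪 →ₐ[𝒪] MvPolynomial (σ × Fin (n + 1 + 1)) 𝒪 :=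
  MvPolynomial.rename fun s => (s.1, s.2.castSucc)

/-- The lift of Frobenius `T^(i) ↦ (T^(i)) ^ q + π T^(i+1)` on polynomial rings. -/
def freeFrob (n : ℕ) :
    MvPolynomial (σ × Fin (n + 1)) 𝒪 →ₐ[𝒪] MvPolynomial (σ × Fin (n + 1 + 1)) 𝒪 :=
  MvPolynomial.aeval fun s =>
    .X (s.1, s.2.castSucc) ^ residueCard π + algebraMap 𝒪 _ π * .X (s.1, s.2.succ)

theorem freeFrob_dvd (n : ℕ) (Q : MvPolynomial (σ × Fin (n + 1)) 𝒪) :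
    algebraMap 𝒪 _ π ∣ freeFrob π σ n Q - freeHom σ n Q ^ residueCard π :=
  dvd_sub_pow_of_X π _ _ (fun s => by simp [freeFrob, freeHom]) Q

/-- The `π`-derivation attached to `freeFrob`. -/
def freeDeriv (n : ℕ) (Q : MvPolynomial (σ × Fin (n + 1)) 𝒪) :
    MvPolynomial (σ × Fin (n + 1 + 1)) 𝒪 := (freeFrob_dvd π σ n Q).choose

theorem pi_mul_freeDeriv (n : ℕ) (Q : MvPolynomial (σ × Fin (n + 1)) 𝒪) :
    algebraMap 𝒪 _ π * freeDeriv π σ n Q = freeFrob π σ n Q - freeHom σ n Q ^ residueCard π :=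
  (freeFrob_dvd π σ n Q).choose_spec.symm

theorem freeHom_freeFrob (n : ℕ) (Q : MvPolynomial (σ × Fin (n + 1)) 𝒪) :
    freeHom σ (n + 1) (freeFrob π σ n Q) = freeFrob π σ (n + 1) (freeHom σ n Q) := by
  rw [← AlgHom.comp_apply, ← AlgHom.comp_apply]
  congr 1
  ext1 s
  simp [freeHom, freeFrob]

/-- The free prolongation sequence on a set of jet variables. -/
def free : ProlongationSequence.{v, max v u} π where
  ring n := MvPolynomial (σ × Fin (n + 1)) 𝒪
  hom n := freeHom σ n
  deriv n := freeDeriv π σ n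
  deriv_add n x y := by
    refine mul_left_cancel₀ (algebraMap_pi_ne_zero π _) ?_
    rw [mul_add, mul_add, pi_mul_aeval_carryPoly]
    simp only [pi_mul_freeDeriv, map_add]
    ring
  deriv_mul n x y := by
    refine mul_left_cancel₀ (algebraMap_pi_ne_zero π _) ?_
    have hx := pi_mul_freeDeriv π σ n x
    have hy := pi_mul_freeDeriv π σ n y
    rw [pi_mul_freeDeriv, map_mul, map_mul]
    linear_combination (-freeHom σ n x ^ residueCard π) * hy -
      freeHom σ n y ^ residueCard π * hx -
      algebraMap 𝒪 _ π * freeDeriv π σ n y * hx - (freeFrob π σ n x - freeHom σ n x ^ residueCard π) * hy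
  hom_deriv n x := by
    refine mul_left_cancel₀ (algebraMap_pi_ne_zero π _) ?_
    rw [pi_mul_freeDeriv, ← freeHom_freeFrob, ← AlgHom.commutes (freeHom σ (n + 1)) π, ← map_mul,
      pi_mul_freeDeriv, map_sub, map_pow]
  deriv_algebraMap n c := by
    refine mul_left_cancel₀ (algebraMap_pi_ne_zero π _) ?_
    rw [pi_mul_freeDeriv, ← map_mul, pi_mul_baseDeriv, AlgHom.commutes, AlgHom.commutes, map_sub,
      map_pow]

variable {π σ}

variable (π) in
/-- The jet variables. -/
def freeX {n : ℕ} (s : σ × Fin (n + 1)) : (free π σ).ring n :=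
  (MvPolynomial.X s : MvPolynomial (σ × Fin (n + 1)) 𝒪)

theorem free_hom_X {n : ℕ} (s : σ × Fin (n + 1)) :
    (free π σ).hom n (freeX π s) = freeX π (s.1, s.2.castSucc) := MvPolynomial.rename_X _ _

theorem free_deriv_X {n : ℕ} (s : σ × Fin (n + 1)) :
    (free π σ).deriv n (freeX π s) = freeX π (s.1, s.2.succ) := by
  have h : freeDeriv π σ n (.X s) = .X (s.1, s.2.succ) := by
    refine mul_left_cancel₀ (algebraMap_pi_ne_zero π _) ?_
    rw [pi_mul_freeDeriv]
    simp [freeFrob, freeHom]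
  exact h

theorem free_induction {n : ℕ} {P : (free π σ).ring n → Prop} (Q : (free π σ).ring n)
    (hC : ∀ c : 𝒪, P (algebraMap 𝒪 _ c)) (hadd : ∀ x y, P x → P y → P (x + y))
    (hX : ∀ x s, P x → P (x * freeX π s)) : P Q :=
  MvPolynomial.induction_on (σ := σ × Fin (n + 1)) (motive := P) Q hC hadd hX

theorem free_ghost_injective {m n : ℕ} {x y : WittVec π n ((free π σ).ring m)}
    (h : ∀ i, x.ghost i = y.ghost i) : x = y := WittVec.ghost_injective h

variable (π) (σ)

theorem wittSum_free_add (N i : ℕ) (h : i ≤ N) (x y : (free π σ).ring 0) :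
    WittVec.wittSum π ((free π σ).expSeq N (x + y)) i =
      WittVec.wittSum π ((free π σ).expSeq N x) i +
        WittVec.wittSum π ((free π σ).expSeq N y) i := by
  induction N generalizing i with
  | zero => obtain rfl := Nat.le_zero.1 h; simp [WittVec.wittSum, expSeq]
  | succ N ih =>
    rcases Nat.lt_or_ge N i with h' | h'
    · obtain rfl : i = N + 1 := by omega
      simp only [wittSum_expSeq_succ, ih N le_rfl, map_add]
    · simp only [wittSum_expSeq_of_le _ h', ih i h', map_add]

theorem wittSum_free_mul (N i : ℕ) (h : i ≤ N) (x y : (free π σ).ring 0) :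
    WittVec.wittSum π ((free π σ).expSeq N (x * y)) i =
      WittVec.wittSum π ((free π σ).expSeq N x) i *
        WittVec.wittSum π ((free π σ).expSeq N y) i := by
  induction N generalizing i with
  | zero => obtain rfl := Nat.le_zero.1 h; simp [WittVec.wittSum, expSeq]
  | succ N ih =>
    rcases Nat.lt_or_ge N i with h' | h'
    · obtain rfl : i = N + 1 := by omega
      simp only [wittSum_expSeq_succ, ih N le_rfl, map_mul]
    · simp only [wittSum_expSeq_of_le _ h', ih i h', map_mul]

theorem wittSum_free_algebraMap (N i : ℕ) (h : i ≤ N) (c : 𝒪) :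
    WittVec.wittSum π ((free π σ).expSeq N (algebraMap 𝒪 _ c)) i = algebraMap 𝒪 _ c := by
  induction N generalizing i with
  | zero => obtain rfl := Nat.le_zero.1 h; simp [WittVec.wittSum, expSeq]
  | succ N ih =>
    rcases Nat.lt_or_ge N i with h' | h'
    · obtain rfl : i = N + 1 := by omega
      simp only [wittSum_expSeq_succ, ih N le_rfl, AlgHom.commutes]
    · simp only [wittSum_expSeq_of_le _ h', ih i h', AlgHom.commutes]

end Free

/-- The elements `c, δ c, …, δ ^ N c` of `R_N`. -/
def derivSeq : (N : ℕ) → R.ring 0 → ℕ → R.ring N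
  | 0, c, _ => c
  | N + 1, c, i => if i ≤ N then R.hom N (derivSeq N c i) else R.deriv N (derivSeq N c N)

theorem derivSeq_succ_of_le {N i : ℕ} (h : i ≤ N) (c : R.ring 0) :
    R.derivSeq (N + 1) c i = R.hom N (R.derivSeq N c i) := by rw [derivSeq, if_pos h]

theorem derivSeq_succ_succ {N i : ℕ} (h : i ≤ N) (c : R.ring 0) :
    R.derivSeq (N + 1) c (i + 1) = R.deriv N (R.derivSeq N c i) := by
  induction N with
  | zero => obtain rfl := Nat.le_zero.1 h; rfl
  | succ N ih =>
    rcases Nat.lt_or_ge N i with h' | h'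
    · obtain rfl : i = N + 1 := by omega
      rw [derivSeq, if_neg (by omega)]
    · rw [derivSeq_succ_of_le _ (by omega), ih h', R.hom_deriv, derivSeq_succ_of_le _ h']

/-- Evaluation of jet polynomials in the variables indexed by `R_0`. -/
def eval (N : ℕ) : (free π (R.ring 0)).ring N →ₐ[𝒪] R.ring N :=
  MvPolynomial.aeval (σ := R.ring 0 × Fin (N + 1)) fun s => R.derivSeq N s.1 s.2

theorem eval_X {N : ℕ} (s : R.ring 0 × Fin (N + 1)) :
    R.eval N (freeX π s) = R.derivSeq N s.1 s.2 := MvPolynomial.aeval_X _ _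

theorem eval_hom (N : ℕ) (Q : (free π (R.ring 0)).ring N) :
    R.eval (N + 1) ((free π (R.ring 0)).hom N Q) = R.hom N (R.eval N Q) := by
  refine free_induction (P := fun Q => R.eval (N + 1) ((free π (R.ring 0)).hom N Q) =
    R.hom N (R.eval N Q)) Q (fun c => ?_) (fun P Q hP hQ => ?_) (fun P s hP => ?_)
  · simp only [AlgHom.commutes]
  · simp only [map_add, hP, hQ]
  · rw [map_mul, map_mul, map_mul, map_mul, hP, free_hom_X, eval_X, eval_X]
    exact congrArg _ (R.derivSeq_succ_of_le (Nat.lt_succ_iff.1 s.2.2) _)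

theorem eval_deriv (N : ℕ) (Q : (free π (R.ring 0)).ring N) :
    R.eval (N + 1) ((free π (R.ring 0)).deriv N Q) = R.deriv N (R.eval N Q) := by
  refine free_induction (P := fun Q => R.eval (N + 1) ((free π (R.ring 0)).deriv N Q) =
    R.deriv N (R.eval N Q)) Q (fun c => ?_) (fun P Q hP hQ => ?_) (fun P s hP => ?_)
  · rw [deriv_algebraMap, AlgHom.commutes, AlgHom.commutes, deriv_algebraMap]
  · rw [deriv_add, map_add, map_add, hP, hQ, map_aeval_pair, eval_hom, eval_hom, map_add,
      deriv_add]
  · have hX : R.eval (N + 1) ((free π (R.ring 0)).deriv N (freeX π s)) =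
        R.deriv N (R.eval N (freeX π s)) := by
      rw [free_deriv_X, eval_X, eval_X]
      exact R.derivSeq_succ_succ (Nat.lt_succ_iff.1 s.2.2) _
    rw [deriv_mul, map_mul, deriv_mul]
    simp only [map_add, map_mul, map_pow, eval_hom, AlgHom.commutes, hP, hX]

theorem eval_expSeq (N i : ℕ) (Q : (free π (R.ring 0)).ring 0) :
    R.eval N ((free π (R.ring 0)).expSeq N Q i) = R.expSeq N (R.eval 0 Q) i := by
  induction N generalizing i with
  | zero => rfl
  | succ N ih =>
    rw [expSeq, expSeq]
    split_ifs
    · rw [eval_hom, ih]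
    · rw [map_sum]
      refine Finset.sum_congr rfl fun k _ => ?_
      rw [map_aeval_pair, map_pow, eval_hom, eval_deriv, ih]

theorem eval_zero_surjective : Function.Surjective (R.eval 0) := fun c =>
  ⟨freeX π (c, 0), R.eval_X (c, 0)⟩

/-- The underlying map `c ↦ (P_0(c), …, P_n(c))` of `exp`. -/
def expFun (n : ℕ) (c : R.ring 0) : WittVec π n (R.ring n) := ⟨fun i => R.expSeq n c i⟩

theorem ghost_expFun (n : ℕ) (c : R.ring 0) (i : Fin (n + 1)) :
    (R.expFun n c).ghost i = WittVec.wittSum π (R.expSeq n c) i :=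
  WittVec.wittSum_congr fun k hk => by
    have : k < n + 1 := by have := i.2; omega
    simp [this, expFun]

theorem mapFun_expFun (n : ℕ) (Q : (free π (R.ring 0)).ring 0) :
    WittVec.mapFun (R.eval n) ((free π (R.ring 0)).expFun n Q) = R.expFun n (R.eval 0 Q) := by
  ext i
  exact R.eval_expSeq n i Q

theorem expFun_algebraMap (n : ℕ) (c : 𝒪) :
    R.expFun n (algebraMap 𝒪 _ c) = algebraMap 𝒪 _ c := by
  rw [← AlgHom.commutes (R.eval 0), ← mapFun_expFun, WittVec.algebraMap_apply,
    ← WittVec.mapFun_scalar (R.eval n)]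
  exact congrArg _ (free_ghost_injective fun i => by
    rw [ghost_expFun, WittVec.ghost_scalar]
    exact wittSum_free_algebraMap π _ n i (Nat.lt_succ_iff.1 i.2) c)

/-- The canonical homomorphism of `𝒪`-algebras `R_0 → W_n(R_n)`. -/
def exp (n : ℕ) : R.ring 0 →ₐ[𝒪] WittVec π n (R.ring n) where
  toFun := R.expFun n
  map_zero' := by simpa using R.expFun_algebraMap n 0
  map_one' := by simpa using R.expFun_algebraMap n 1
  map_add' x y := by
    obtain ⟨x, rfl⟩ := R.eval_zero_surjective x
    obtain ⟨y, rfl⟩ := R.eval_zero_surjective y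
    rw [← map_add, ← mapFun_expFun, ← mapFun_expFun, ← mapFun_expFun, ← WittVec.mapFun_add]
    exact congrArg _ (free_ghost_injective fun i => by
      rw [WittVec.ghost_add]
      simp only [ghost_expFun]
      exact wittSum_free_add π _ n i (Nat.lt_succ_iff.1 i.2) x y)
  map_mul' x y := by
    obtain ⟨x, rfl⟩ := R.eval_zero_surjective x
    obtain ⟨y, rfl⟩ := R.eval_zero_surjective y
    rw [← map_mul, ← mapFun_expFun, ← mapFun_expFun, ← mapFun_expFun, ← WittVec.mapFun_mul]
    exact congrArg _ (free_ghost_injective fun i => by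
      rw [WittVec.ghost_mul]
      simp only [ghost_expFun]
      exact wittSum_free_mul π _ n i (Nat.lt_succ_iff.1 i.2) x y)
  commutes' := R.expFun_algebraMap n

end ProlongationSequence

end Prolongation

/-! ### Sheaves of sets on affine schemes -/

section Sheaves

/-- The category of affine schemes over `Spec R`: the opposite of the category of commutative
`R`-algebras. -/
abbrev Aff (R : Type u) [CommRing R] : Type (u + 1) := (CommAlgCat.{u} R)ᵒᵖ

variable (R : Type u) [CommRing R]

/-- The functor from affine schemes over `Spec R` to schemes. -/
def Aff.toScheme : Aff.{u} R ⥤ AlgebraicGeometry.Scheme.{u} :=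
  (forget₂ (CommAlgCat.{u} R) CommRingCat.{u}).op ⋙ AlgebraicGeometry.Scheme.Spec

/-- The étale topology on affine schemes over `Spec R`, generated by the jointly surjective families
of étale morphisms. -/
def etaleTopology : GrothendieckTopology (Aff.{u} R) :=
  (AlgebraicGeometry.Scheme.etalePrecoverage.{u}.comap (Aff.toScheme.{u} R)).toGrothendieck

/-- The category of sheaves of sets on affine schemes over `Spec R` with the étale topology. -/
abbrev Sp : Type _ := Sheaf (etaleTopology.{u} R) (Type w)

variable {R}

/-- A nilpotent closed immersion `Spec (B / I) → Spec B` of affine schemes, where `I ^ m = 0` for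
some `m`. -/
def IsNilpotentClosedImmersion {T' T : Aff.{u} R} (i : T' ⟶ T) : Prop :=
  Function.Surjective i.unop.hom ∧ IsNilpotent (RingHom.ker i.unop.hom)

variable {X Y : (Aff.{u} R)ᵒᵖ ⥤ Type w}

/-- The map `X(T) → X(T') ×_{Y(T')} Y(T)` induced by a morphism `i : T' → T`. -/
def toFiberProduct (f : X ⟶ Y) {T' T : Aff.{u} R} (i : T' ⟶ T) (x : X.obj (op T)) :
    {p : X.obj (op T') × Y.obj (op T) // f.app (op T') p.1 = Y.map i.op p.2} :=
  ⟨(X.map i.op x, f.app (op T) x), NatTrans.naturality_apply f i.op x⟩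

/-- `f` is formally étale if `X(T) → X(T') ×_{Y(T')} Y(T)` is bijective for every nilpotent closed
immersion `T' → T` of affine schemes over `Spec R`. -/
def IsFormallyEtale (f : X ⟶ Y) : Prop :=
  ∀ ⦃T' T : Aff.{u} R⦄ (i : T' ⟶ T), IsNilpotentClosedImmersion i →
    Function.Bijective (toFiberProduct f i)

/-- The functor `T ↦ Hom_Y(T, X)` on affine schemes over `Y`. An affine scheme over `Y` is a pair
`(T, y)` with `y ∈ Y(T)`, and `Hom_Y(T, X)` is the set of all `x ∈ X(T)` with `f(x) = y`. The
category of affine schemes over `Y` is the opposite of `Y.Elements`. -/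
def homOver (f : X ⟶ Y) : Y.Elements ⥤ Type w where
  obj p := {x : X.obj p.1 // f.app p.1 x = p.2}
  map {p p'} g := TypeCat.ofHom fun x => ⟨X.map g.1 x.1, by
    rw [NatTrans.naturality_apply, x.2, g.2]⟩
  map_id p := by
    ext x
    exact ConcreteCategory.congr_hom (X.map_id p.1) x.1
  map_comp g h := by
    ext x
    exact ConcreteCategory.congr_hom (X.map_comp g.1 h.1) x.1

/-- For a cocone `c` on a diagram of pairs `(T_j, y_j)`, the sets `Hom_Y(T_j, X)` with their maps to
`Hom_Y(T, X)`, where `T` is the point of `c`. -/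
def homOverCocone (f : X ⟶ Y) {J : Type u} [SmallCategory J] {D : J ⥤ Y.Elements} (c : Cocone D) :
    (D ⋙ homOver f).CoconeTypes where
  pt := (homOver f).obj c.pt
  ι j := (homOver f).map (c.ι.app j)
  ι_naturality {j j'} g := by
    rw [← c.w g, Functor.map_comp]
    rfl

/-- `f` is locally of finite presentation if, for every cofiltered system `(T_j)` of affine schemes
over `Y` with limit `T`, the map `colim_j Hom_Y(T_j, X) → Hom_Y(T, X)` is bijective. The system is
given by the opposite diagram `D` in `Y.Elements`, indexed by a filtered category, and `T` is its
limit among affine schemes over `Spec R`. -/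
def IsLocallyOfFinitePresentation (f : X ⟶ Y) : Prop :=
  ∀ (J : Type u) [SmallCategory J] [IsFiltered J] (D : J ⥤ Y.Elements) (c : Cocone D),
    Nonempty (IsColimit ((CategoryOfElements.π Y).mapCocone c)) →
      Function.Bijective ((D ⋙ homOver f).descColimitType (homOverCocone f c))

/-- `f` is étale if it is locally of finite presentation and formally étale. -/
def IsEtale (f : X ⟶ Y) : Prop := IsLocallyOfFinitePresentation f ∧ IsFormallyEtale f

end Sheaves

/-! ### Jet spaces -/

namespace ProlongationSequence

variable {𝒪 : Type v} [CommRing 𝒪] {π : 𝒪} [IsDomain 𝒪] [Fact (Prime π)]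
  [Finite (𝒪 ⧸ Ideal.span {π})] (R : ProlongationSequence.{v, u} π) (n : ℕ)

/-- Restriction of scalars from `R_n`-algebras to `𝒪`-algebras. -/
abbrev baseAlgebra (B : Type u) [CommRing B] [Algebra (R.ring n) B] : Algebra 𝒪 B :=
  Algebra.compHom B (algebraMap 𝒪 (R.ring n))

/-- The ring `W_n(B)` attached to an `R_n`-algebra `B`. -/
def WittRing (B : Type u) [CommRing B] [Algebra (R.ring n) B] : Type u := WittVec π n B

variable (B : Type u) [CommRing B] [Algebra (R.ring n) B]

instance : CommRing (R.WittRing n B) :=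
  letI := R.baseAlgebra n B
  inferInstanceAs (CommRing (WittVec π n B))

/-- The structure map of an `R_n`-algebra, as a homomorphism of `𝒪`-algebras. -/
def structureMap : letI := R.baseAlgebra n B; R.ring n →ₐ[𝒪] B :=
  letI := R.baseAlgebra n B
  { algebraMap (R.ring n) B with commutes' := fun _ => rfl }

/-- The structure of `R_0`-algebra on `W_n(B)`, given by `R_0 → W_n(R_n) → W_n(B)`. -/
instance : Algebra (R.ring 0) (R.WittRing n B) :=
  letI := R.baseAlgebra n B
  ((WittVec.map π n (R.structureMap n B)).comp (R.exp n)).toRingHom.toAlgebra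

variable {B} {C : Type u} [CommRing C] [Algebra (R.ring n) C]

/-- The homomorphism of `R_0`-algebras `W_n(f)`, acting componentwise. -/
def wittMap (f : B →ₐ[R.ring n] C) : R.WittRing n B →ₐ[R.ring 0] R.WittRing n C :=
  letI := R.baseAlgebra n B
  letI := R.baseAlgebra n C
  { WittVec.map π n ({ f with commutes' := fun c => f.commutes (algebraMap 𝒪 _ c) } : B →ₐ[𝒪] C)
    with
    commutes' := fun c => by
      refine WittVec.ext (funext fun i => ?_)
      exact f.commutes ((R.exp n c).coeff i) }

/-- The functor `B ↦ W_n(B)` from `R_n`-algebras to `R_0`-algebras. -/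
def witt : CommAlgCat.{u} (R.ring n) ⥤ CommAlgCat.{u} (R.ring 0) where
  obj B := .of (R.ring 0) (R.WittRing n B)
  map f := CommAlgCat.ofHom (R.wittMap n f.hom)

/-- The jet space `J^n X` of a sheaf `X` over `R_0`: the functor on affine schemes over `R_n` with
`(J^n X)(B) = X(W_n(B))` for every `R_n`-algebra `B`. -/
def jet (X : Sp.{w, u} (R.ring 0)) : (Aff.{u} (R.ring n))ᵒᵖ ⥤ Type w :=
  (R.witt n).op.op ⋙ X.obj

/-- The morphism `J^n f : J^n X → J^n Y`. -/
def jetMap {X Y : Sp.{w, u} (R.ring 0)} (f : X ⟶ Y) : R.jet n X ⟶ R.jet n Y :=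
  Functor.whiskerLeft (R.witt n).op.op f.hom

end ProlongationSequence

end

/-! By definition `J^n X` is `X` precomposed with the functor `W_n` from `R_n`-algebras to
`R_0`-algebras. Each of the two properties quantifies over a class of diagrams of rings (nilpotent
quotients, filtered colimits), so it passes from `f` to `J^n f` once `W_n` carries the class over
`R_n` into the class over `R_0`.

For formal étaleness, let `B → B/I` be a quotient with `I` nilpotent. As a map of sets `W_n(B) →
W_n(B/I)` is an `(n+1)`-fold power, so it is surjective, and its kernel is `W_n(I)`, the Witt
vectors with all components in `I`. The content is that this kernel is nilpotent. The components of
a product `xy` are polynomials in the components of `x` and `y`, and every monomial in them involves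
at least one component of each factor. Hence `W_n(I) W_n(J) ⊆ W_n(IJ)` (`mul_mem_coeffIdeal_mul`),
so `W_n(I)^m ⊆ W_n(I^m)`, which vanishes when `I^m = 0`.

For local finite presentation, `W_n` preserves filtered colimits: on underlying sets it is `B ↦
B^(n+1)`, finite powers commute with filtered colimits of sets, and the forgetful functor from
algebras to sets both preserves and reflects filtered colimits. -/

namespace WittVec

/-! ### Ideals of Witt vectors and their nilpotence -/

section Ideals

variable {𝒪 : Type v} [CommRing 𝒪] {π : 𝒪} [IsDomain 𝒪] [Fact (Prime π)]
  [Finite (𝒪 ⧸ Ideal.span {π})] {n : ℕ} {B : Type u} [CommRing B] [Algebra 𝒪 B]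

/-- The zero of `W_n(B)` is characterised by its ghost components. These determine the Witt
components over a polynomial ring, and the result descends to `B` along `presentation`. -/
theorem coeff_zero (i : Fin (n + 1)) : (0 : WittVec π n B).coeff i = 0 := by
  have h : (0 : WittVec π n (MvPolynomial B 𝒪)) = ⟨fun _ => 0⟩ := by
    refine ghost_injective fun i => ?_
    rw [ghost_zero, ghost, wittSum]
    refine (Finset.sum_eq_zero fun k _ => ?_).symm
    -- Needed for `0 ^ q ^ (i - k) = 0`, which would fail for a vanishing exponent.
    have hq : residueCard π ≠ 0 := Nat.card_pos.ne'
    simp [hq]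
  rw [← mapFun_zero (presentation 𝒪 B), h]
  exact map_zero (presentation 𝒪 B)

/-- The ideal `W_n(I)` of Witt vectors with all components in `I`. -/
noncomputable def coeffIdeal (π : 𝒪) [Fact (Prime π)] [Finite (𝒪 ⧸ Ideal.span {π})] (n : ℕ) (I : Ideal B) :
    Ideal (WittVec π n B) :=
  RingHom.ker (map π n (Ideal.Quotient.mkₐ 𝒪 I))

theorem map_eq_zero_iff {C : Type*} [CommRing C] [Algebra 𝒪 C] (f : B →ₐ[𝒪] C)
    (x : WittVec π n B) : map π n f x = 0 ↔ ∀ i, f (x.coeff i) = 0 := by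
  rw [WittVec.ext_iff, funext_iff]
  exact forall_congr' fun i => by rw [coeff_zero]; rfl

theorem mem_coeffIdeal {I : Ideal B} {x : WittVec π n B} :
    x ∈ coeffIdeal π n I ↔ ∀ i, x.coeff i ∈ I := by
  rw [coeffIdeal, RingHom.mem_ker, map_eq_zero_iff]
  simp only [Ideal.Quotient.mkₐ_eq_mk, Ideal.Quotient.eq_zero_iff_mem]

/-- The `j`-th generic vector lies in `W_n` of the ideal generated by its own variables. That set is
the kernel of a ring homomorphism, so it absorbs multiplication by the other generic vector. Hence
no explicit formula for the product polynomials is required. -/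
theorem generic_mul_coeff_mem (j : Fin 2) (i : Fin (n + 1)) :
    (generic π n (m := 2) 0 * generic π n 1).coeff i ∈
      Ideal.span (MvPolynomial.X '' {s : Fin 2 × Fin (n + 1) | s.1 = j}) := by
  have hj : generic π n j ∈ coeffIdeal π n
      (Ideal.span (MvPolynomial.X '' {s : Fin 2 × Fin (n + 1) | s.1 = j})) :=
    mem_coeffIdeal.2 fun k => Ideal.subset_span ⟨(j, k), rfl, rfl⟩
  refine mem_coeffIdeal.1 ?_ i
  fin_cases j
  · exact Ideal.mul_mem_right _ _ hj
  · exact Ideal.mul_mem_left _ _ hj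

/-- The product is a specialisation of the generic one, whose components have only monomials
divisible by some `X (0, k) * X (1, l)`. Such a monomial specialises to a multiple of `x_k y_l ∈ I *
J`. -/
theorem mul_mem_coeffIdeal_mul {I J : Ideal B} {x y : WittVec π n B} (hx : x ∈ coeffIdeal π n I)
    (hy : y ∈ coeffIdeal π n J) : x * y ∈ coeffIdeal π n (I * J) := by
  rw [mem_coeffIdeal] at hx hy ⊢
  intro i
  let e : MvPolynomial (Fin 2 × Fin (n + 1)) 𝒪 →ₐ[𝒪] B :=
    MvPolynomial.aeval fun s => (![x, y] s.1).coeff s.2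
  have h0 : mapFun e (generic π n (0 : Fin 2)) = x := by ext k; simp [mapFun, e, generic]
  have h1 : mapFun e (generic π n (1 : Fin 2)) = y := by ext k; simp [mapFun, e, generic]
  have h : x * y = mapFun e (generic π n (0 : Fin 2) * generic π n 1) := by rw [mapFun_mul, h0, h1]
  rw [h]
  change e ((generic π n (0 : Fin 2) * generic π n 1).coeff i) ∈ I * J
  -- Membership in an ideal generated by variables is a condition on each monomial of the support.
  -- This is all that is retained of the product polynomial.
  have hm0 := MvPolynomial.mem_ideal_span_X_image.1 (generic_mul_coeff_mem (π := π) 0 i)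
  have hm1 := MvPolynomial.mem_ideal_span_X_image.1 (generic_mul_coeff_mem (π := π) 1 i)
  generalize (generic π n (0 : Fin 2) * generic π n 1).coeff i = P at hm0 hm1 ⊢
  rw [P.as_sum, map_sum]
  refine Ideal.sum_mem _ fun m hm => ?_
  obtain ⟨⟨_, k⟩, rfl : _ = (0 : Fin 2), hk⟩ := hm0 m hm
  obtain ⟨⟨_, l⟩, rfl : _ = (1 : Fin 2), hl⟩ := hm1 m hm
  have hX : MvPolynomial.monomial m (P.coeff m) ∈
      Ideal.span {(.X (0, k) * .X (1, l) : MvPolynomial (Fin 2 × Fin (n + 1)) 𝒪)} := by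
    rw [Ideal.mem_span_singleton, MvPolynomial.X, MvPolynomial.X, MvPolynomial.monomial_mul,
      MvPolynomial.monomial_dvd_monomial]
    -- Compare exponents variable by variable. The two variables are distinct because their first
    -- indices are `0` and `1`, so no exponent `2` is ever demanded.
    refine ⟨Or.inr fun s => ?_, by simp⟩
    rw [Finsupp.add_apply, Finsupp.single_apply, Finsupp.single_apply]
    split_ifs with h1 h2 h2
    · simp [← h2] at h1
    · subst h1; exact Nat.one_le_iff_ne_zero.2 hk
    · subst h2; exact Nat.one_le_iff_ne_zero.2 hl
    · exact Nat.zero_le _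
  obtain ⟨Q, hQ⟩ := Ideal.mem_span_singleton.1 hX
  rw [hQ, map_mul, map_mul]
  refine Ideal.mul_mem_right _ _ (Ideal.mul_mem_mul ?_ ?_)
  · simpa [e] using hx k
  · simpa [e] using hy l

theorem coeffIdeal_pow_le (I : Ideal B) (m : ℕ) :
    coeffIdeal π n I ^ m ≤ coeffIdeal π n (I ^ m) := by
  induction m with
  | zero => exact fun x _ => mem_coeffIdeal.2 fun i => by simp
  | succ m ih =>
    rw [pow_succ, pow_succ, Ideal.mul_le]
    exact fun x hx y hy => mul_mem_coeffIdeal_mul (ih hx) hy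

theorem isNilpotent_coeffIdeal {I : Ideal B} (hI : IsNilpotent I) :
    IsNilpotent (coeffIdeal π n I) := by
  obtain ⟨m, hm⟩ := hI
  refine ⟨m, le_bot_iff.1 ((coeffIdeal_pow_le I m).trans fun x hx => ?_)⟩
  rw [hm, mem_coeffIdeal] at hx
  rw [Ideal.mem_bot, WittVec.ext_iff, funext_iff]
  exact fun i => by rw [coeff_zero]; exact hx i

end Ideals

end WittVec

/-! ### Filtered colimits of commutative algebras -/

section FilteredColimits

variable {R : Type u} [CommRing R]

/-- Algebras over `R` are rings under `R`. Forgetting the map from `R` preserves connected colimits,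
in particular filtered ones, and rings have their filtered colimits computed on underlying sets. -/
instance : PreservesFilteredColimits (forget (CommAlgCat.{u} R)) where
  preserves_filtered_colimits J _ _ :=
    inferInstanceAs (PreservesColimitsOfShape J ((commAlgCatEquivUnder (.of R)).functor ⋙
      Under.forget _ ⋙ forget CommRingCat.{u}))

end FilteredColimits

/-! ### The functor `W_n` on nilpotent immersions and filtered colimits -/

namespace ProlongationSequence

variable {𝒪 : Type v} [CommRing 𝒪] {π : 𝒪} [IsDomain 𝒪] [Fact (Prime π)]
  [Finite (𝒪 ⧸ Ideal.span {π})] (R : ProlongationSequence.{v, u} π) (n : ℕ)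

theorem isNilpotentClosedImmersion_witt {T' T : Aff.{u} (R.ring n)} {i : T' ⟶ T}
    (hi : IsNilpotentClosedImmersion i) : IsNilpotentClosedImmersion ((R.witt n).op.map i) := by
  let := R.baseAlgebra n T.unop
  let := R.baseAlgebra n T'.unop
  refine ⟨fun y => ?_, ?_⟩
  -- A set-theoretic section is enough, because the map on Witt vectors acts componentwise.
  · choose g hg using hi.1
    exact ⟨⟨fun k => g (y.coeff k)⟩, WittVec.ext (funext fun k => hg _)⟩
  · have hker : RingHom.ker ((R.witt n).op.map i).unop.hom =
        WittVec.coeffIdeal π n (RingHom.ker i.unop.hom) :=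
      Ideal.ext fun (x : WittVec π n T.unop) => (WittVec.map_eq_zero_iff _ x).trans
        (WittVec.mem_coeffIdeal (I := RingHom.ker i.unop.hom)).symm
    rw [hker]
    exact WittVec.isNilpotent_coeffIdeal hi.2

/-- Componentwise, `W_n` is a finite power of the identity functor. -/
instance preservesColimitsOfShape_witt_forget (J : Type u) [SmallCategory J] [IsFiltered J] :
    PreservesColimitsOfShape J (R.witt n ⋙ forget (CommAlgCat.{u} (R.ring 0))) where
  preservesColimit {D} := ⟨fun {c} hc => by
    have hc' := isColimitOfPreserves (forget (CommAlgCat.{u} (R.ring n))) hc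
    -- Two conditions remain: every vector comes from some stage, and two vectors of one stage with
    -- equal image in the colimit agree at a later stage.
    refine ⟨Types.FilteredColimit.isColimitOf' _ _ (fun (x : WittVec π n c.pt) => ?_)
      (fun j (x : WittVec π n (D.obj j)) (y : WittVec π n (D.obj j)) hxy => ?_)⟩
    · choose a b hab using fun k => Types.jointly_surjective_of_isColimit hc' (x.coeff k)
      -- The finitely many components, lifted at separate stages `a k`, are moved to a common one.
      obtain ⟨j, hj⟩ := IsFiltered.sup_objs_exists (Set.finite_range a).toFinset
      have g : ∀ k, a k ⟶ j := fun k => (hj (by simp)).some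
      refine ⟨j, (⟨fun k => D.map (g k) (b k)⟩ : WittVec π n (D.obj j)),
        WittVec.ext (funext fun k => ?_)⟩
      exact (hab k).symm.trans (ConcreteCategory.congr_hom (c.w (g k)) (b k)).symm
    · have hk : ∀ k, ∃ (l : J) (g : j ⟶ l), D.map g (x.coeff k) = D.map g (y.coeff k) := fun k =>
        (Types.FilteredColimit.isColimit_eq_iff' hc' (x.coeff k) (y.coeff k)).1
          (congrFun (congrArg WittVec.coeff hxy) k)
      choose l g hg using hk
      -- A common target of the `l k` is not enough: the composites from `j` must be one and the
      -- same arrow `α`, as a single transition map acts on all components. A cocone on the finite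
      -- wide span of the `g k` provides this.
      obtain ⟨m, α, β, h⟩ : ∃ (m : J) (α : j ⟶ m) (β : ∀ k, l k ⟶ m), ∀ k, g k ≫ β k = α := by
        obtain ⟨s⟩ := IsFiltered.cocone_nonempty (WidePushoutShape.wideSpan j l g)
        exact ⟨s.pt, s.ι.app none, fun k => s.ι.app (some k), fun k => s.w (.init k)⟩
      refine ⟨m, α, WittVec.ext (funext fun k => ?_)⟩
      change D.map α (x.coeff k) = D.map α (y.coeff k)
      rw [← h k, D.map_comp, CommAlgCat.comp_apply, CommAlgCat.comp_apply, hg]⟩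

/-- The forgetful functor reflects isomorphisms and preserves these colimits, hence reflects them.
It is therefore enough to know the claim on underlying sets. -/
instance (J : Type u) [SmallCategory J] [IsFiltered J] :
    PreservesColimitsOfShape J (R.witt n) where
  preservesColimit :=
    haveI := reflectsColimitsOfShape_of_reflectsIsomorphisms (J := J)
      (G := forget (CommAlgCat.{u} (R.ring 0)))
    preservesColimit_of_reflects_of_preserves (R.witt n) (forget (CommAlgCat.{u} (R.ring 0)))

/-- The double opposite appears because presheaves on affine schemes live on the opposite of an
opposite category. It is `W_n` conjugated by an equivalence. -/
instance (J : Type u) [SmallCategory J] [IsFiltered J] :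
    PreservesColimitsOfShape J (R.witt n).op.op :=
  inferInstanceAs (PreservesColimitsOfShape J ((opOpEquivalence _).functor ⋙ R.witt n ⋙
    (opOpEquivalence _).inverse))

/-! ### Transfer of the properties to jet spaces -/

variable {X Y : Sp.{w, u} (R.ring 0)}

/-- The functor `(B, y) ↦ (W_n(B), y)` on elements of `J^n Y`. -/
noncomputable def jetElements (Y : Sp.{w, u} (R.ring 0)) : (R.jet n Y).Elements ⥤ Y.obj.Elements where
  obj p := ⟨(R.witt n).op.op.obj p.1, p.2⟩
  map g := ⟨(R.witt n).op.op.map g.1, g.2⟩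

/-- The comparison map of `J^n f` at `i` is, by definition, that of `f` at `W_n(i)`. -/
theorem isFormallyEtale_jetMap {f : X ⟶ Y} (hf : IsFormallyEtale f.hom) :
    IsFormallyEtale (R.jetMap n f) := fun _ _ i hi =>
  hf ((R.witt n).op.map i) (R.isNilpotentClosedImmersion_witt n hi)

/-- A system over `J^n Y` becomes a system over `Y` through `jetElements`, and the sets of lifts to
`J^n X` and to `X` coincide by definition. Preservation of filtered colimits by `W_n` ensures that
the new system has the expected limit. -/
theorem isLocallyOfFinitePresentation_jetMap {f : X ⟶ Y}
    (hf : IsLocallyOfFinitePresentation f.hom) :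
    IsLocallyOfFinitePresentation (R.jetMap n f) := fun J _ _ D c ⟨hc⟩ =>
  hf J (D ⋙ R.jetElements n Y) ((R.jetElements n Y).mapCocone c)
    ⟨isColimitOfPreserves (R.witt n).op.op hc⟩

end ProlongationSequence

/-- If a morphism of étale sheaves over `R_0` is formally étale (respectively locally of finite
presentation, respectively étale), then so is the induced morphism of jet spaces over `R_n`. -/
theorem proposition3p2 {𝒪 : Type v} [CommRing 𝒪] [IsDedekindDomain 𝒪] (π : 𝒪) [Fact (Prime π)]
    [Finite (𝒪 ⧸ Ideal.span {π})] (R : ProlongationSequence.{v, u} π) (n : ℕ)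
    {X Y : Sp.{w, u} (R.ring 0)} (f : X ⟶ Y) :
    (IsFormallyEtale f.hom → IsFormallyEtale (R.jetMap n f)) ∧
    (IsLocallyOfFinitePresentation f.hom → IsLocallyOfFinitePresentation (R.jetMap n f)) ∧
    (IsEtale f.hom → IsEtale (R.jetMap n f)) :=
  ⟨R.isFormallyEtale_jetMap n, R.isLocallyOfFinitePresentation_jetMap n, fun hf =>
    ⟨R.isLocallyOfFinitePresentation_jetMap n hf.1, R.isFormallyEtale_jetMap n hf.2⟩⟩
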